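/- Let $R$ be a reflexive binary relation on a set $U$. For $x\in U$ put $R(x)=\{y\in U : (x,y)\in R\}$, and for $X\subseteq U$ put \[ X^\blacktriangledown=\{x\in U : R(x)\subseteq X\},\qquad X^\blacktriangle=\{x\in U : R(x)\cap X\neq\emptyset\}. \] Let $\wp(U)^\blacktriangle=\{X^\blacktriangle : X\subseteq U\}$, a complete lattice under inclusion, and let $\mathcal S=\{x\in U : |R(x)|=1\}$. Let $\mathrm{RS}=\{(X^\blacktriangledown,X^\blacktriangle) : X\subseteq U\}$, ordered coordinatewise by inclusion, and let $\mathrm{DM(RS)}$ be its Dedekind--MacNeille completion, equipped with the order-reversing involution ${\sim}$ that extends the map $(X^\blacktriangledown,X^\blacktriangle)\mapsto (U\setminus X^\blacktriangle,\,U\setminus X^\blacktriangledown)$ of $\mathrm{RS}$. An element $j$ of a complete lattice $L$ is completely join-irreducible if $j=\bigvee S$ implies $j\in S$ for every $S\subseteq L$. The lattice $L$ is spatial if each of its elements is the join of the completely join-irreducible elements below it. It is completely distributive if $\bigwedge_{i\in I}\bigvee_{j\in J}x_{i,j}=\bigvee_{f\colon I\to J}\bigwedge_{i\in I}x_{i,f(i)}$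 for every doubly indexed family in $L$. A Kleene algebra is a bounded distributive lattice with a unary operation ${\sim}$ satisfying ${\sim}{\sim}a=a$, the two De Morgan laws, and $a\wedge{\sim}a\le b\vee{\sim}b$. It is a Nelson algebra if for all $a,b$ there is a greatest element $a\to b$ among the elements $c$ with $a\wedge c\le{\sim}a\vee b$, and $(a\wedge b)\to c=a\to(b\to c)$ for all $a,b,c$. Assume that $\mathrm{DM(RS)}$ is completely distributive and spatial. Then the following are equivalent: (i) $\mathrm{DM(RS)}$, with the operation ${\sim}$, is a Nelson algebra. (ii) For all $x,y\in U\setminus\mathcal S$ such that $\{x\}^\blacktriangle$ and $\{y\}^\blacktriangle$ are completely join-irreducible in $\wp(U)^\blacktriangle$: if $\{x\}^\blacktriangle\subseteq\{u\}^\blacktriangle$ and $\{y\}^\blacktriangle\subseteq\{u\}^\blacktriangle$ for some $u\in U$, then there is $z\in U$ such that $\{z\}^\blacktriangle$ is completely join-irreducible in $\wp(U)^\blacktriangle$, $\{x\}^\blacktriangle\subseteq\{z\}^\blacktriangle$ and $\{y\}^\blacktriangle\subseteq\{z\}^\blacktriangle$. -/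

import Mathlib

namespace RoughSet

universe u

section Lattice

variable {L : Type u}

/-- `j` is completely join-irreducible: `j = ⋁ S` implies `j ∈ S`, for every subset `S`. -/
def IsCompletelyJoinIrreducible [CompleteLattice L] (j : L) : Prop :=
  ∀ S : Set L, j = sSup S → j ∈ S

variable (L) in
/-- A complete lattice is completely distributive if any meet of joins of a doubly indexed family
is the join, over all choice functions, of the corresponding meets. -/
def IsCompletelyDistributive [CompleteLattice L] : Prop :=
  ∀ (I J : Type u) (x : I → J → L), (⨅ i, ⨆ j, x i j) = ⨆ f : I → J, ⨅ i, x i (f i)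

variable (L) in
/-- A complete lattice is spatial if each element is the join of the completely join-irreducible
elements below it. -/
def IsSpatial [CompleteLattice L] : Prop :=
  ∀ x : L, x = sSup {j : L | IsCompletelyJoinIrreducible j ∧ j ≤ x}

/-- `(L, ∨, ∧, neg, 0, 1)` is a De Morgan algebra. -/
structure IsDeMorganAlgebra [Lattice L] [BoundedOrder L] (neg : L → L) : Prop where
  inf_sup_left : ∀ x y z : L, x ⊓ (y ⊔ z) = (x ⊓ y) ⊔ (x ⊓ z)
  neg_neg : ∀ x : L, neg (neg x) = x
  neg_sup : ∀ x y : L, neg (x ⊔ y) = neg x ⊓ neg y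
  neg_inf : ∀ x y : L, neg (x ⊓ y) = neg x ⊔ neg y

/-- `(L, ∨, ∧, neg, 0, 1)` is a Kleene algebra, in the sense of De Morgan algebras. -/
structure IsKleeneAlgebra [Lattice L] [BoundedOrder L] (neg : L → L) : Prop
    extends IsDeMorganAlgebra neg where
  inf_neg_le_sup_neg : ∀ x y : L, x ⊓ neg x ≤ y ⊔ neg y

/-- `c` is the relative pseudocomplement `a ⇒ b`: the greatest `x` with `a ∧ x ≤ b`. -/
def IsRelativePseudocomplement [Lattice L] (a b c : L) : Prop :=
  IsGreatest {x : L | a ⊓ x ≤ b} c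

/-- `(L, ∨, ∧, neg, 0, 1)` forms a Nelson algebra: it is a Kleene algebra in which all the weak
relative pseudocomplements `a → b := a ⇒ (neg a ∨ b)` exist (that is, a quasi-Nelson algebra), and
`→` satisfies the identity `(a ∧ b) → c = a → (b → c)`. -/
structure IsNelsonAlgebra [Lattice L] [BoundedOrder L] (neg : L → L) : Prop
    extends IsKleeneAlgebra neg where
  exists_imp : ∃ imp : L → L → L,
    (∀ a b : L, IsRelativePseudocomplement a (neg a ⊔ b) (imp a b)) ∧
    ∀ a b c : L, imp (a ⊓ b) c = imp a (imp b c)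

end Lattice

section Approximation

variable {U : Type u} (R : U → U → Prop)

/-- The neighbourhood `R(x)`. -/
def nbhd (x : U) : Set U := {y | R x y}

/-- The lower approximation `X^▼`. -/
def lower (X : Set U) : Set U := {x | nbhd R x ⊆ X}

/-- The upper approximation `X^▲`. -/
def upper (X : Set U) : Set U := {x | (nbhd R x ∩ X).Nonempty}

/-- The set `𝒮` of singletons: the points `x` such that `R(x)` has exactly one element. -/
def singletons : Set U := {x | ∃ z, nbhd R x = {z}}

theorem lower_compl (X : Set U) : lower R Xᶜ = (upper R X)ᶜ := by
  ext x
  simp [lower, upper, Set.subset_compl_iff_disjoint_right, Set.not_nonempty_iff_eq_empty,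
    Set.disjoint_iff_inter_eq_empty]

theorem upper_compl (X : Set U) : upper R Xᶜ = (lower R X)ᶜ := by
  rw [← compl_compl (upper R Xᶜ), ← lower_compl, compl_compl]

theorem upper_biUnion (H : Set (Set U)) : upper R (⋃ X ∈ H, X) = ⋃ X ∈ H, upper R X := by
  ext x
  simp only [upper, Set.mem_ofPred_eq, Set.mem_iUnion, Set.inter_iUnion, Set.nonempty_iUnion,
    exists_prop]

/-- The family `℘(U)^▲` of all upper approximations, ordered by inclusion. -/
def upperFamily : Set (Set U) := {Y | ∃ X, Y = upper R X}

theorem sUnion_mem_upperFamily (H : Set (Set U)) (hH : H ⊆ upperFamily R) :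
    ⋃₀ H ∈ upperFamily R := by
  refine ⟨⋃ X ∈ {X | upper R X ∈ H}, X, ?_⟩
  rw [upper_biUnion]
  ext x
  simp only [Set.mem_sUnion, Set.mem_iUnion, Set.mem_ofPred_eq, exists_prop]
  constructor
  · rintro ⟨Y, hY, hx⟩
    obtain ⟨X, rfl⟩ := hH hY
    exact ⟨X, hY, hx⟩
  · rintro ⟨X, hX, hx⟩
    exact ⟨_, hX, hx⟩

/-- Joins in `℘(U)^▲` are unions. -/
instance : SupSet (upperFamily R) where
  sSup H := ⟨⋃₀ (Subtype.val '' H), sUnion_mem_upperFamily R _ (by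
    rintro _ ⟨Y, -, rfl⟩
    exact Y.2)⟩

theorem isLUB_sSup_upperFamily (H : Set (upperFamily R)) : IsLUB H (sSup H) :=
  ⟨fun Y hY => Set.subset_sUnion_of_mem (Set.mem_image_of_mem Subtype.val hY),
    fun _ hZ => Set.sUnion_subset (by
      rintro _ ⟨Y, hY, rfl⟩
      exact hZ hY)⟩

/-- `℘(U)^▲` is a complete lattice with respect to inclusion. -/
instance : CompleteLattice (upperFamily R) :=
  completeLatticeOfSup _ (isLUB_sSup_upperFamily R)

/-- `{x}^▲`, as an element of the complete lattice `℘(U)^▲`. -/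
def upperSingleton (x : U) : upperFamily R := ⟨upper R {x}, {x}, rfl⟩

/-- The ordered set `RS` of all rough sets `(X^▼, X^▲)`, ordered coordinatewise by inclusion. -/
abbrev RS : Type u := {p : Set U × Set U // ∃ X : Set U, p = (lower R X, upper R X)}

/-- The Dedekind–MacNeille completion `DM(RS)`. -/
abbrev DM : Type u := DedekindCut (RS R)

variable {R}

/-- The complementation `(X^▼, X^▲) ↦ ((X^▲)ᶜ, (X^▼)ᶜ) = (Xᶜ^▼, Xᶜ^▲)` of rough sets. -/
def RS.neg (p : RS R) : RS R :=
  ⟨(p.1.2ᶜ, p.1.1ᶜ), by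
    obtain ⟨_, X, rfl⟩ := p
    exact ⟨Xᶜ, by rw [lower_compl, upper_compl]⟩⟩

theorem RS.neg_neg (p : RS R) : p.neg.neg = p :=
  Subtype.ext (Prod.ext (compl_compl _) (compl_compl _))

theorem RS.neg_le_neg {p q : RS R} (h : p ≤ q) : q.neg ≤ p.neg :=
  ⟨Set.compl_subset_compl.2 h.2, Set.compl_subset_compl.2 h.1⟩

theorem RS.neg_le_iff {p q : RS R} : p.neg ≤ q ↔ q.neg ≤ p :=
  ⟨fun h => by simpa only [RS.neg_neg] using RS.neg_le_neg h,
    fun h => by simpa only [RS.neg_neg] using RS.neg_le_neg h⟩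

theorem RS.le_neg_iff {p q : RS R} : p ≤ q.neg ↔ q ≤ p.neg :=
  ⟨fun h => by simpa only [RS.neg_neg] using RS.neg_le_neg h,
    fun h => by simpa only [RS.neg_neg] using RS.neg_le_neg h⟩

/-- The negation of `DM(RS)`: the order-reversing extension of the complementation of rough sets,
sending a cut to the cut whose lower part consists of the complements of the elements of the upper
part, and vice versa. If a cut is represented by the pair `(A, B)`, where `A` is the intersection
of the lower approximations `p.1` for `p` in its upper part, and `B` is the union of the upper
approximations `p.2` for `p` in its lower part, then this is `(A, B) ↦ (Bᶜ, Aᶜ)`. -/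
def DM.neg (c : DM R) : DM R where
  extent := {p | p.neg ∈ c.intent}
  intent := {p | p.neg ∈ c.extent}
  upperPolar_extent := by
    ext q
    rw [Set.mem_ofPred_eq, ← c.lowerPolar_intent]
    constructor
    · intro h p hp
      exact RS.neg_le_iff.2 (h (show p.neg.neg ∈ c.intent by rwa [RS.neg_neg]))
    · intro h p hp
      simpa only [RS.neg_neg] using RS.neg_le_iff.1 (h hp)
  lowerPolar_intent := by
    ext q
    rw [Set.mem_ofPred_eq, ← c.upperPolar_extent]
    constructor
    · intro h p hp
      exact RS.le_neg_iff.2 (h (show p.neg.neg ∈ c.extent by rwa [RS.neg_neg]))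
    · intro h p hp
      simpa only [RS.neg_neg] using RS.le_neg_iff.1 (h hp)

/-- On the rough sets themselves, the negation of `DM(RS)` is the complementation. -/
theorem DM.neg_principal (p : RS R) :
    DM.neg (DedekindCut.principal p) = DedekindCut.principal p.neg := by
  refine DedekindCut.ext ?_
  ext q
  exact RS.le_neg_iff.symm

end Approximation

end RoughSet

/-! Complete distributivity makes completely join-irreducible elements completely join-prime, and
with spatiality inequalities can be tested on these primes. Each prime `j` has a dual prime `dual
neg j` with `j ≤ neg c` exactly when `¬ dual neg j ≤ c`, so negation becomes an order-reversing
involution on primes; by the Kleene inequality, `j` and its dual are comparable. On primes, the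
Nelson identity amounts to `Interpolation`.

In `DM R` every element is a join of cuts of sets `{x}` and `R(w)`, so each prime is one of these,
and duality exchanges the two kinds. A prime below its dual is either self-dual, hence its own
interpolant, or a point cut with `x ∉ 𝒮`. For prime point cuts, `p ≤ dual q` means that some `{u}^▲`
contains both sets, while primality of the cut is irreducibility of `{x}^▲`. Interpolation thus
becomes (ii). -/

namespace RoughSet

universe u

/-! ### Completely join-prime elements and their duals -/

section Prime

variable {L : Type u} [CompleteLattice L]

/-- `j` is completely join-prime: `j ≤ ⋁ S` implies `j ≤ s` for some `s ∈ S`. -/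
def IsCompletelyJoinPrime (j : L) : Prop :=
  ∀ S : Set L, j ≤ sSup S → ∃ s ∈ S, j ≤ s

theorem IsCompletelyJoinIrreducible.isCompletelyJoinPrime (hL : IsCompletelyDistributive L) {j : L}
    (hj : IsCompletelyJoinIrreducible j) : IsCompletelyJoinPrime j := by
  classical
  intro S hS
  -- Distributivity is applied to `j ⊓ sSup S`; both joins need the common index type `L`, so
  -- indices outside `S` are padded with `⊥`.
  let x : ULift.{u} Bool → L → L := fun i s => if i.down then j else if s ∈ S then s else ⊥
  have hx : j = sSup (Set.range fun f : ULift.{u} Bool → L => ⨅ i, x i (f i)) := by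
    rw [sSup_range, ← hL]
    refine le_antisymm (le_iInf ?_) ?_
    · rintro ⟨_ | _⟩
      · refine hS.trans (sSup_le fun s hs => le_iSup_of_le s ?_)
        simp [x, hs]
      · exact le_iSup_of_le j (by simp [x])
    · exact (iInf_le _ ⟨true⟩).trans (iSup_le fun s => by simp [x])
  obtain ⟨f, hf⟩ := hj _ hx
  have hle : j ≤ x ⟨false⟩ (f ⟨false⟩) := hf.ge.trans (iInf_le _ _)
  by_cases hs : f ⟨false⟩ ∈ S
  · exact ⟨_, hs, by simpa [x, hs] using hle⟩
  · have hbot : j = sSup ∅ := by simpa [x, hs] using hle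
    exact absurd (hj _ hbot) (Set.notMem_empty _)

theorem IsCompletelyJoinPrime.le_sup {j x y : L} (hj : IsCompletelyJoinPrime j)
    (h : j ≤ x ⊔ y) : j ≤ x ∨ j ≤ y := by
  obtain ⟨s, rfl | rfl, hs⟩ := hj {x, y} (by rwa [sSup_pair])
  exacts [Or.inl hs, Or.inr hs]

variable (L) in
/-- The order of `L` is determined by its completely join-prime elements. -/
def HasEnoughPrimes : Prop :=
  ∀ x y : L, (∀ j, IsCompletelyJoinPrime j → j ≤ x → j ≤ y) → x ≤ y

theorem IsSpatial.hasEnoughPrimes (hL : IsCompletelyDistributive L) (hs : IsSpatial L) :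
    HasEnoughPrimes L := by
  intro x y h
  rw [hs x]
  exact sSup_le fun j hj => h j (hj.1.isCompletelyJoinPrime hL) hj.2

/-- `neg` is an order-reversing involution. -/
structure IsInvolution (neg : L → L) : Prop where
  neg_neg : ∀ x, neg (neg x) = x
  le_neg : ∀ x y, x ≤ neg y → y ≤ neg x

theorem IsInvolution.le_neg_iff {neg : L → L} (hn : IsInvolution neg) {x y : L} :
    x ≤ neg y ↔ y ≤ neg x :=
  ⟨hn.le_neg x y, hn.le_neg y x⟩

theorem IsInvolution.neg_le_iff {neg : L → L} (hn : IsInvolution neg) {x y : L} :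
    neg x ≤ y ↔ neg y ≤ x := by
  have h := hn.le_neg_iff (x := neg x) (y := neg y)
  rwa [hn.neg_neg, hn.neg_neg] at h

theorem IsInvolution.neg_sup {neg : L → L} (hn : IsInvolution neg) (x y : L) :
    neg (x ⊔ y) = neg x ⊓ neg y := by
  refine eq_of_forall_le_iff fun z => ?_
  rw [hn.le_neg_iff, sup_le_iff, le_inf_iff, hn.le_neg_iff (y := x), hn.le_neg_iff (y := y)]

theorem IsInvolution.neg_inf {neg : L → L} (hn : IsInvolution neg) (x y : L) :
    neg (x ⊓ y) = neg x ⊔ neg y := by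
  rw [← hn.neg_neg (neg x ⊔ neg y), hn.neg_sup, hn.neg_neg, hn.neg_neg]

/-- The dual of a completely join-prime element `j`: the negation of the largest element that is
not above `j`. -/
def dual (neg : L → L) (j : L) : L := neg (sSup {c | ¬ j ≤ c})

section Dual

variable {neg : L → L} {j k : L}

/-- Primality says that the join of all elements not above `j` is still not above `j`; negating this
largest element gives the dual. -/
theorem IsCompletelyJoinPrime.le_neg_iff (hn : IsInvolution neg) (hj : IsCompletelyJoinPrime j)
    {c : L} : j ≤ neg c ↔ ¬ dual neg j ≤ c := by
  rw [← not_iff_not, not_not, dual, hn.neg_le_iff]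
  refine ⟨fun h => le_sSup h, fun h hc => ?_⟩
  obtain ⟨s, hs, hjs⟩ := hj _ (hc.trans h)
  exact hs hjs

theorem IsCompletelyJoinPrime.prime_dual (hn : IsInvolution neg) (hj : IsCompletelyJoinPrime j) :
    IsCompletelyJoinPrime (dual neg j) := by
  intro S hS
  by_contra! h
  refine (hj.le_neg_iff hn).1 (hn.le_neg_iff.1 (sSup_le fun s hs => ?_)) hS
  exact hn.le_neg_iff.1 ((hj.le_neg_iff hn).2 (h s hs))

theorem IsCompletelyJoinPrime.dual_dual (hn : IsInvolution neg) (hj : IsCompletelyJoinPrime j) :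
    dual neg (dual neg j) = j := by
  refine eq_of_forall_ge_iff fun c => ?_
  rw [← not_iff_not, ← (hj.prime_dual hn).le_neg_iff hn, ← not_iff_not, ← hj.le_neg_iff hn,
    hn.neg_neg, not_not]

theorem IsCompletelyJoinPrime.dual_le_dual (hn : IsInvolution neg) (hj : IsCompletelyJoinPrime j)
    (hk : IsCompletelyJoinPrime k) (h : j ≤ k) : dual neg k ≤ dual neg j := by
  by_contra hkj
  exact (hj.le_neg_iff hn).1 (h.trans ((hk.le_neg_iff hn).2 hkj)) le_rfl

/-- The Kleene inequality is used with `y = dual neg j`, since `j` is never below `neg (dual neg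
j)`. -/
theorem IsCompletelyJoinPrime.le_dual_of_le (hn : IsInvolution neg)
    (hkl : ∀ x y : L, x ⊓ neg x ≤ y ⊔ neg y) (hj : IsCompletelyJoinPrime j) {x : L}
    (hx : j ≤ x) (hx' : j ≤ neg x) : j ≤ dual neg j := by
  rcases hj.le_sup ((le_inf hx hx').trans (hkl x (dual neg j))) with h | h
  · exact h
  · exact absurd le_rfl ((hj.le_neg_iff hn).1 h)

theorem IsCompletelyJoinPrime.le_dual_or_dual_le (hn : IsInvolution neg)
    (hkl : ∀ x y : L, x ⊓ neg x ≤ y ⊔ neg y) (hj : IsCompletelyJoinPrime j) :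
    j ≤ dual neg j ∨ dual neg j ≤ j := by
  by_cases h : j ≤ neg j
  · exact Or.inl (hj.le_dual_of_le hn hkl le_rfl h)
  · exact Or.inr (not_not.1 fun h' => h ((hj.le_neg_iff hn).2 h'))

end Dual

/-- The interpolation property: if `p, q ≤ dual p, dual q`, then some completely join-prime `r`
lies between `p, q` and `dual p, dual q`. -/
def Interpolation (neg : L → L) : Prop :=
  ∀ p q : L, IsCompletelyJoinPrime p → IsCompletelyJoinPrime q →
    p ≤ dual neg p → q ≤ dual neg q → p ≤ dual neg q →
    ∃ r, IsCompletelyJoinPrime r ∧ p ≤ r ∧ q ≤ r ∧ r ≤ dual neg p ∧ r ≤ dual neg q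

/-! ### The Nelson identity and interpolation -/

section Nelson

variable {neg : L → L}

theorem HasEnoughPrimes.inf_sup_left (hL : HasEnoughPrimes L) (x y z : L) :
    x ⊓ (y ⊔ z) = (x ⊓ y) ⊔ (x ⊓ z) := by
  refine le_antisymm (hL _ _ fun j hj h => ?_) le_inf_sup
  obtain ⟨hx, hyz⟩ := le_inf_iff.1 h
  rcases hj.le_sup hyz with hy | hz
  · exact (le_inf hx hy).trans le_sup_left
  · exact (le_inf hx hz).trans le_sup_right

theorem HasEnoughPrimes.isGreatest_sSup (hL : HasEnoughPrimes L) (a b : L) :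
    IsRelativePseudocomplement a b (sSup {x | a ⊓ x ≤ b}) := by
  refine ⟨hL _ _ fun j hj h => ?_, fun x hx => le_sSup hx⟩
  obtain ⟨ha, hj'⟩ := le_inf_iff.1 h
  obtain ⟨x, hx, hjx⟩ := hj _ hj'
  exact (le_inf ha hjx).trans hx

theorem IsRelativePseudocomplement.le_iff {a b c x : L} (h : IsRelativePseudocomplement a b c) :
    x ≤ c ↔ a ⊓ x ≤ b :=
  ⟨fun hx => (inf_le_inf_left a hx).trans h.1, fun hx => h.2 hx⟩

theorem Interpolation.isNelsonAlgebra (hL : HasEnoughPrimes L) (hn : IsInvolution neg)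
    (hkl : ∀ x y : L, x ⊓ neg x ≤ y ⊔ neg y) (hi : Interpolation neg) :
    IsNelsonAlgebra neg where
  inf_sup_left := hL.inf_sup_left
  neg_neg := hn.neg_neg
  neg_sup := hn.neg_sup
  neg_inf := hn.neg_inf
  inf_neg_le_sup_neg := hkl
  exists_imp := by
    let imp : L → L → L := fun a b => sSup {x | a ⊓ x ≤ neg a ⊔ b}
    have himp : ∀ a b, IsRelativePseudocomplement a (neg a ⊔ b) (imp a b) :=
      fun a b => hL.isGreatest_sSup a (neg a ⊔ b)
    refine ⟨imp, himp, fun a b c => le_antisymm ?_ ?_⟩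
    · rw [(himp a _).le_iff]
      refine hL _ _ fun j hj h => ?_
      obtain ⟨hja, hjx⟩ := le_inf_iff.1 h
      have hjx := (himp _ _).le_iff.1 hjx
      rw [hn.neg_inf] at hjx
      by_cases hjna : j ≤ neg a
      · exact hjna.trans le_sup_left
      have hga : dual neg j ≤ a := not_not.1 fun h' => hjna ((hj.le_neg_iff hn).2 h')
      refine le_trans ?_ le_sup_right
      rw [(himp b c).le_iff]
      refine hL _ _ fun k hk h => ?_
      obtain ⟨hkb, hkj⟩ := le_inf_iff.1 h
      by_cases hknb : k ≤ neg b
      · exact hknb.trans le_sup_left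
      have hgb : dual neg k ≤ b := not_not.1 fun h' => hknb ((hk.le_neg_iff hn).2 h')
      refine le_trans ?_ le_sup_right
      -- The only troublesome case is `k ≤ neg a`. It is resolved by a prime between `k` and `j`
      -- that lies below `a` and `b` but below neither negation, hence below `c`: `j` itself if `j ≤
      -- dual neg j`, otherwise an interpolant of `k` and `dual neg j`.
      rcases hk.le_sup ((le_inf (le_inf (hkj.trans hja) hkb) hkj).trans hjx) with h | hkc
      swap
      · exact hkc
      rcases hk.le_sup h with hkna | h
      swap
      · exact absurd h hknb
      have hkk : k ≤ dual neg k := hk.le_dual_of_le hn hkl (hkj.trans hja) hkna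
      have hgjk : dual neg j ≤ dual neg k := hk.dual_le_dual hn hj hkj
      rcases hj.le_dual_or_dual_le hn hkl with hjj | hjj
      · rcases hj.le_sup ((le_inf (le_inf hja ((hjj.trans hgjk).trans hgb)) le_rfl).trans hjx)
          with h | h
        · rcases hj.le_sup h with h | h
          · exact absurd h hjna
          · exact absurd (hgjk.trans hgb) ((hj.le_neg_iff hn).1 h)
        · exact hkj.trans h
      · obtain ⟨r, hr, hkr, hjr, hrk, hrj⟩ := hi k (dual neg j) hk (hj.prime_dual hn) hkk
          (hjj.trans (hj.dual_dual hn).ge) (hkj.trans (hj.dual_dual hn).ge)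
        rw [hj.dual_dual hn] at hrj
        rcases hr.le_sup ((le_inf (le_inf (hrj.trans hja) (hrk.trans hgb)) hrj).trans hjx)
          with h | h
        · rcases hr.le_sup h with h | h
          · refine absurd ?_ ((hr.le_neg_iff hn).1 h)
            exact ((hj.prime_dual hn).dual_le_dual hn hr hjr).trans ((hj.dual_dual hn).le.trans hja)
          · refine absurd ?_ ((hr.le_neg_iff hn).1 h)
            exact (hk.dual_le_dual hn hr hkr).trans hgb
        · exact hkr.trans h
    · rw [(himp (a ⊓ b) c).le_iff]
      refine hL _ _ fun j hj h => ?_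
      obtain ⟨⟨hja, hjb⟩, hjx⟩ := le_inf_iff.1 h |>.imp_left le_inf_iff.1
      rw [hn.neg_inf]
      rcases hj.le_sup ((le_inf hja hjx).trans (himp _ _).1) with h | h
      · exact h.trans (le_sup_left.trans le_sup_left)
      · rcases hj.le_sup ((le_inf hjb h).trans (himp _ _).1) with h | h
        · exact h.trans (le_sup_right.trans le_sup_left)
        · exact h.trans le_sup_right

theorem IsNelsonAlgebra.interpolation (hL : HasEnoughPrimes L) (hn : IsInvolution neg)
    (hN : IsNelsonAlgebra neg) : Interpolation neg := by
  intro p q hp hq hpp hqq hpq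
  by_contra! hr
  obtain ⟨imp, himp, hid⟩ := hN.exists_imp
  -- A prime violating this inequality would be an interpolant. The Nelson identity then turns the
  -- inequality into a contradiction with `p ≤ dual neg p`, `p ≤ dual neg q` and `q ≤ dual neg q`.
  have hle : dual neg q ⊓ dual neg p ≤ neg (dual neg q) ⊔ neg (dual neg p) := by
    refine hL _ _ fun r hrp h => ?_
    obtain ⟨hrq, hrp'⟩ := le_inf_iff.1 h
    by_contra hcon
    have h1 : dual neg r ≤ dual neg q := not_not.1 fun h' =>
      hcon (((hrp.le_neg_iff hn).2 h').trans le_sup_left)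
    have h2 : dual neg r ≤ dual neg p := not_not.1 fun h' =>
      hcon (((hrp.le_neg_iff hn).2 h').trans le_sup_right)
    have h1' := (hrp.prime_dual hn).dual_le_dual hn (hq.prime_dual hn) h1
    have h2' := (hrp.prime_dual hn).dual_le_dual hn (hp.prime_dual hn) h2
    rw [hrp.dual_dual hn, hq.dual_dual hn] at h1'
    rw [hrp.dual_dual hn, hp.dual_dual hn] at h2'
    exact hr r hrp h2' h1' hrp' hrq
  have h1 : dual neg q ≤ imp (dual neg q) (imp (dual neg p) ⊥) := by
    rw [← hid, (himp _ _).le_iff, hn.neg_inf]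
    exact inf_le_left.trans (hle.trans le_sup_left)
  rw [(himp _ _).le_iff, inf_idem] at h1
  rcases (hq.prime_dual hn).le_sup h1 with h | h
  · rw [(hq.prime_dual hn).le_neg_iff hn, hq.dual_dual hn] at h
    exact h hqq
  · rw [(himp _ _).le_iff, sup_bot_eq] at h
    exact (hp.le_neg_iff hn).1 ((le_inf hpp hpq).trans h) le_rfl

end Nelson

end Prime

/-! ### Cuts of points and of neighbourhoods generate `DM R` -/

section Cuts

open DedekindCut

variable {U : Type u} (R : U → U → Prop)

/-- The cut of the rough set of `X`. -/
def roughCut (X : Set U) : DM R := principal ⟨(lower R X, upper R X), X, rfl⟩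

/-- The cut of the rough set of `{x}`. -/
def pointCut (x : U) : DM R := roughCut R {x}

/-- The cut of the rough set of `R(w)`. -/
def nbhdCut (w : U) : DM R := roughCut R (nbhd R w)

variable {R}

theorem roughCut_le_roughCut {X Y : Set U} :
    roughCut R X ≤ roughCut R Y ↔ lower R X ⊆ lower R Y ∧ upper R X ⊆ upper R Y :=
  principal_le_principal

theorem exists_roughCut_eq (p : RS R) : ∃ X, principal p = roughCut R X := by
  obtain ⟨_, X, rfl⟩ := p
  exact ⟨X, rfl⟩

theorem neg_roughCut (X : Set U) : DM.neg (roughCut R X) = roughCut R Xᶜ := by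
  rw [roughCut, DM.neg_principal, roughCut]
  congr 1
  exact Subtype.ext (Prod.ext (lower_compl R X).symm (upper_compl R X).symm)

theorem le_iff_forall_roughCut_le {c d : DM R} :
    c ≤ d ↔ ∀ X, roughCut R X ≤ c → roughCut R X ≤ d := by
  refine ⟨fun h X hX => hX.trans h, fun h p hp => ?_⟩
  obtain ⟨X, hX⟩ := exists_roughCut_eq p
  exact principal_le_iff.1 (hX ▸ h X (hX ▸ principal_le_iff.2 hp))

theorem le_iff_forall_le_roughCut {c d : DM R} :
    c ≤ d ↔ ∀ X, d ≤ roughCut R X → c ≤ roughCut R X := by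
  refine ⟨fun h X hX => h.trans hX, fun h => ?_⟩
  rw [← Concept.intent_subset_intent_iff]
  intro p hp
  obtain ⟨X, hX⟩ := exists_roughCut_eq p
  exact le_principal_iff.1 (hX ▸ h X (hX ▸ le_principal_iff.2 hp))

theorem isInvolution_neg : IsInvolution (DM.neg : DM R → DM R) where
  neg_neg c := by
    refine DedekindCut.ext (Set.ext fun p => ?_)
    change p.neg.neg ∈ c.extent ↔ p ∈ c.extent
    rw [RS.neg_neg]
  le_neg c d h := by
    rw [← Concept.intent_subset_intent_iff]
    intro p hp
    have := h (show p.neg ∈ c.extent from hp)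
    change p.neg.neg ∈ d.intent at this
    rwa [RS.neg_neg] at this

theorem lower_subset_upper (hR : ∀ x, R x x) (X : Set U) : lower R X ⊆ upper R X :=
  fun x hx => ⟨x, hR x, hx (hR x)⟩

theorem upper_eq_biUnion (X : Set U) : upper R X = ⋃ x ∈ X, upper R {x} := by
  ext y
  simp [upper, Set.Nonempty, and_comm]

theorem mem_upper_singleton {x y : U} : y ∈ upper R {x} ↔ R y x := by
  simp [upper, nbhd]

theorem nbhd_eq_singleton (hR : ∀ x, R x x) {x z : U} (h : nbhd R x = {z}) : x = z := by
  have : x ∈ nbhd R x := hR x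
  rwa [h] at this

theorem inf_neg_le_sup_neg (hR : ∀ x, R x x) (c d : DM R) :
    c ⊓ DM.neg c ≤ d ⊔ DM.neg d := by
  rw [le_iff_forall_roughCut_le]
  intro X hX
  rw [le_iff_forall_le_roughCut]
  intro Y hY
  obtain ⟨h1, h2⟩ := le_inf_iff.1 hX
  obtain ⟨h3, h4⟩ := sup_le_iff.1 hY
  have hXX := h1.trans (isInvolution_neg.le_neg _ _ h2)
  have hYY := (isInvolution_neg.neg_le_iff.1 h4).trans h3
  rw [neg_roughCut, roughCut_le_roughCut, lower_compl, upper_compl] at hXX hYY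
  refine roughCut_le_roughCut.2 ⟨fun x hx => ?_, fun x _ => ?_⟩
  · exact absurd (lower_subset_upper hR X hx) (hXX.1 hx)
  · by_contra hx
    exact hx (lower_subset_upper hR Y (hYY.1 hx))

/-- Lower approximations impose nothing extra: `{x}^▼` can contain only `x`, and only when `R(x) =
{x}`, where `x ∈ Y^▲` already gives `x ∈ Y`. -/
theorem pointCut_le_roughCut (hR : ∀ x, R x x) {x : U} {Y : Set U} :
    pointCut R x ≤ roughCut R Y ↔ upper R {x} ⊆ upper R Y := by
  refine roughCut_le_roughCut.trans ⟨And.right, fun h => ⟨fun y hy => ?_, h⟩⟩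
  have hyx : y = x := hy (hR y)
  subst hyx
  obtain ⟨z, hz, hzY⟩ := h (mem_upper_singleton.2 (hR y))
  have hzy : z = y := hy hz
  subst hzy
  exact hy.trans (Set.singleton_subset_iff.2 hzY)

theorem nbhdCut_le_roughCut {w : U} {Y : Set U} :
    nbhdCut R w ≤ roughCut R Y ↔ nbhd R w ⊆ Y := by
  refine roughCut_le_roughCut.trans ⟨fun h => h.1 (subset_refl (nbhd R w)), fun h => ⟨?_, ?_⟩⟩
  · exact fun y hy => hy.trans h
  · exact fun y ⟨z, hz, hzw⟩ => ⟨z, hz, h hzw⟩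

theorem pointCut_le_pointCut (hR : ∀ x, R x x) {x y : U} :
    pointCut R x ≤ pointCut R y ↔ upper R {x} ⊆ upper R {y} :=
  pointCut_le_roughCut hR

theorem roughCut_le_iff (hR : ∀ x, R x x) {X : Set U} {c : DM R} :
    roughCut R X ≤ c ↔
      (∀ x ∈ X, pointCut R x ≤ c) ∧ ∀ w, nbhd R w ⊆ X → nbhdCut R w ≤ c := by
  refine ⟨fun h => ⟨fun x hx => ?_, fun w hw => ?_⟩, fun ⟨h1, h2⟩ => ?_⟩
  · refine ((pointCut_le_roughCut hR).2 ?_).trans h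
    exact fun y ⟨z, hz, hzx⟩ => ⟨z, hz, (show z = x from hzx) ▸ hx⟩
  · exact (nbhdCut_le_roughCut.2 hw).trans h
  · rw [le_iff_forall_le_roughCut]
    intro Y hY
    refine roughCut_le_roughCut.2 ⟨fun w hw => ?_, ?_⟩
    · exact nbhdCut_le_roughCut.1 ((h2 w hw).trans hY)
    · rw [upper_eq_biUnion X]
      exact Set.iUnion₂_subset fun x hx => (pointCut_le_roughCut hR).1 ((h1 x hx).trans hY)

theorem pointCut_le_nbhdCut (hR : ∀ x, R x x) {x w : U} (h : R w x) :
    pointCut R x ≤ nbhdCut R w :=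
  ((roughCut_le_iff hR).1 le_rfl).1 x h

/-- With `nbhdCut_le_neg`, this is why duality exchanges point cuts and neighbourhood cuts along
`R`. -/
theorem pointCut_le_neg (hR : ∀ x, R x x) {x : U} {c : DM R} :
    pointCut R x ≤ DM.neg c ↔ ∀ w, R w x → ¬ nbhdCut R w ≤ c := by
  rw [isInvolution_neg.le_neg_iff, pointCut, neg_roughCut]
  refine ⟨fun h w hw hwc => nbhdCut_le_roughCut.1 (hwc.trans h) hw rfl, fun h => ?_⟩
  rw [le_iff_forall_roughCut_le]
  intro X hX
  rw [← neg_roughCut, isInvolution_neg.le_neg_iff, neg_roughCut]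
  refine (pointCut_le_roughCut hR).2 fun w hw => ?_
  rw [upper_compl]
  exact fun hwX => h w (mem_upper_singleton.1 hw) ((nbhdCut_le_roughCut.2 hwX).trans hX)

theorem nbhdCut_le_neg (hR : ∀ x, R x x) {w : U} {c : DM R} :
    nbhdCut R w ≤ DM.neg c ↔ ∀ z, R w z → ¬ pointCut R z ≤ c := by
  constructor
  · intro h z hz hzc
    have := (isInvolution_neg.le_neg _ _ h).trans' hzc
    exact (pointCut_le_neg hR).1 this w hz le_rfl
  · intro h
    rw [isInvolution_neg.le_neg_iff, le_iff_forall_roughCut_le]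
    intro X hX
    rw [isInvolution_neg.le_neg_iff, neg_roughCut]
    exact nbhdCut_le_roughCut.2 fun z hz hzX =>
      h z hz ((((roughCut_le_iff hR).1 le_rfl).1 z hzX).trans hX)

/-! ### The primes of `DM R` and their duals -/

theorem IsCompletelyJoinPrime.eq_pointCut_or_eq_nbhdCut (hR : ∀ x, R x x) {j : DM R}
    (hj : IsCompletelyJoinPrime j) : (∃ x, j = pointCut R x) ∨ ∃ w, j = nbhdCut R w := by
  have hle : j ≤ sSup ({c | c ≤ j ∧ ∃ x, c = pointCut R x} ∪
      {c | c ≤ j ∧ ∃ w, c = nbhdCut R w}) := by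
    rw [le_iff_forall_roughCut_le]
    intro X hX
    obtain ⟨h1, h2⟩ := (roughCut_le_iff hR).1 hX
    exact (roughCut_le_iff hR).2 ⟨fun x hx => le_sSup (Or.inl ⟨h1 x hx, x, rfl⟩),
      fun w hw => le_sSup (Or.inr ⟨h2 w hw, w, rfl⟩)⟩
  obtain ⟨c, ⟨hcj, x, hx⟩ | ⟨hcj, w, hw⟩, hjc⟩ := hj _ hle
  · exact Or.inl ⟨x, (le_antisymm hjc hcj).trans hx⟩
  · exact Or.inr ⟨w, (le_antisymm hjc hcj).trans hw⟩

theorem exists_dual_pointCut_eq (hR : ∀ x, R x x) {x : U}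
    (hx : IsCompletelyJoinPrime (pointCut R x)) :
    ∃ w, R w x ∧ dual DM.neg (pointCut R x) = nbhdCut R w := by
  have key := fun c => (hx.le_neg_iff isInvolution_neg (c := c)).symm.trans (pointCut_le_neg hR)
  have h := (key (dual DM.neg (pointCut R x))).not.1 (not_not.2 le_rfl)
  push Not at h
  obtain ⟨w, hw, hle⟩ := h
  -- If the dual were not below `nbhdCut R w`, the criterion with `c = nbhdCut R w` would be
  -- violated by `w` itself.
  exact ⟨w, hw, le_antisymm (not_not.1 fun h' => (key _).1 h' w hw le_rfl) hle⟩

theorem exists_dual_nbhdCut_eq (hR : ∀ x, R x x) {w : U}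
    (hw : IsCompletelyJoinPrime (nbhdCut R w)) :
    ∃ z, R w z ∧ dual DM.neg (nbhdCut R w) = pointCut R z := by
  have key := fun c => (hw.le_neg_iff isInvolution_neg (c := c)).symm.trans (nbhdCut_le_neg hR)
  have h := (key (dual DM.neg (nbhdCut R w))).not.1 (not_not.2 le_rfl)
  push Not at h
  obtain ⟨z, hz, hle⟩ := h
  exact ⟨z, hz, le_antisymm (not_not.1 fun h' => (key _).1 h' z hz le_rfl) hle⟩

/-- The dual of `y` is the cut of some `R(w)` with `w ∈ {y}^▲ ⊆ {u}^▲`, so `u ∈ R(w)`. -/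
theorem IsCompletelyJoinPrime.pointCut_le_dual (hR : ∀ x, R x x) {x y u : U}
    (hy : IsCompletelyJoinPrime (pointCut R y)) (hxu : pointCut R x ≤ pointCut R u)
    (hyu : pointCut R y ≤ pointCut R u) : pointCut R x ≤ dual DM.neg (pointCut R y) := by
  obtain ⟨w, hw, h⟩ := exists_dual_pointCut_eq hR hy
  rw [h]
  refine hxu.trans (pointCut_le_nbhdCut hR ?_)
  exact mem_upper_singleton.1 ((pointCut_le_pointCut hR).1 hyu (mem_upper_singleton.2 hw))

theorem IsCompletelyJoinPrime.exists_le_pointCut (hR : ∀ x, R x x) {x : U} {Y : Set U}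
    (hx : IsCompletelyJoinPrime (pointCut R x)) (h : upper R {x} ⊆ upper R Y) :
    ∃ y ∈ Y, pointCut R x ≤ pointCut R y := by
  have hle : pointCut R x ≤ sSup (pointCut R '' Y) := by
    rw [le_iff_forall_le_roughCut]
    intro Z hZ
    refine (pointCut_le_roughCut hR).2 (h.trans ?_)
    rw [upper_eq_biUnion Y]
    exact Set.iUnion₂_subset fun y hy =>
      (pointCut_le_roughCut hR).1 ((le_sSup (Set.mem_image_of_mem _ hy)).trans hZ)
  obtain ⟨_, ⟨y, hy, rfl⟩, hxy⟩ := hx _ hle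
  exact ⟨y, hy, hxy⟩

theorem IsCompletelyJoinPrime.exists_pointCut_le_of_le_dual (hR : ∀ x, R x x) {x y : U}
    (hx : IsCompletelyJoinPrime (pointCut R x)) (hy : IsCompletelyJoinPrime (pointCut R y))
    (h : pointCut R x ≤ dual DM.neg (pointCut R y)) :
    ∃ u, pointCut R x ≤ pointCut R u ∧ pointCut R y ≤ pointCut R u := by
  obtain ⟨w, hw, hdual⟩ := exists_dual_pointCut_eq hR hy
  rw [hdual] at h
  obtain ⟨u, hu, hxu⟩ := hx.exists_le_pointCut hR ((pointCut_le_roughCut hR).1 h)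
  refine ⟨u, hxu, ?_⟩
  by_contra hyu
  rw [← isInvolution_neg.neg_neg (pointCut R u), hy.le_neg_iff isInvolution_neg, not_not, hdual,
    nbhdCut_le_neg hR] at hyu
  exact hyu u hu le_rfl

/-! ### Irreducibility in `℘(U)^▲` and translation of interpolation -/

theorem IsCompletelyJoinPrime.isCompletelyJoinIrreducible_upperSingleton (hR : ∀ x, R x x) {x : U}
    (hx : IsCompletelyJoinPrime (pointCut R x)) :
    IsCompletelyJoinIrreducible (upperSingleton R x) := by
  intro H hH
  have hval : upper R {x} = ⋃₀ (Subtype.val '' H) := congrArg Subtype.val hH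
  have hle : upper R {x} ⊆ upper R {y | ∃ Y ∈ H, upper R {y} ⊆ Y.1} := by
    rw [hval]
    rintro t ⟨_, ⟨⟨_, X, rfl⟩, hX, rfl⟩, z, hz, hzX⟩
    refine ⟨z, hz, _, hX, ?_⟩
    exact (upper_eq_biUnion X).symm.subset.trans' (Set.subset_biUnion_of_mem
      (u := fun z => upper R {z}) hzX)
  obtain ⟨y, ⟨Y, hY, hyY⟩, hxy⟩ := hx.exists_le_pointCut hR hle
  have : upperSingleton R x = Y := Subtype.ext (subset_antisymm
    (((pointCut_le_pointCut hR).1 hxy).trans hyY)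
    ((Set.subset_sUnion_of_mem (Set.mem_image_of_mem _ hY)).trans hval.symm.subset))
  exact this ▸ hY

theorem nbhdCut_eq_pointCut (hR : ∀ x, R x x) {w x : U} (h : nbhdCut R w ≤ pointCut R x) :
    nbhd R w = {w} ∧ w = x := by
  have hsub : nbhd R w ⊆ {x} := nbhdCut_le_roughCut.1 h
  have hwx : w = x := hsub (hR w)
  subst hwx
  exact ⟨subset_antisymm hsub (Set.singleton_subset_iff.2 (hR w)), rfl⟩

theorem IsCompletelyJoinIrreducible.isCompletelyJoinPrime_pointCut (hR : ∀ x, R x x)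
    (hL : HasEnoughPrimes (DM R)) {x : U}
    (hx : IsCompletelyJoinIrreducible (upperSingleton R x)) :
    IsCompletelyJoinPrime (pointCut R x) := by
  -- A prime neighbourhood cut below forces `R(x) = {x}` and equals the point cut. Otherwise all
  -- primes below are point cuts, whose upper sets cover `{x}^▲`.
  by_cases hex : ∃ w, nbhdCut R w ≤ pointCut R x ∧ IsCompletelyJoinPrime (nbhdCut R w)
  · obtain ⟨w, hwx, hw⟩ := hex
    obtain ⟨hnb, rfl⟩ := nbhdCut_eq_pointCut hR hwx
    rwa [pointCut, ← hnb]
  push Not at hex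
  let Y : Set U := {y | pointCut R y ≤ pointCut R x ∧ IsCompletelyJoinPrime (pointCut R y)}
  have hle : pointCut R x ≤ roughCut R Y := by
    refine hL _ _ fun j hj hjx => ?_
    rcases hj.eq_pointCut_or_eq_nbhdCut hR with ⟨y, rfl⟩ | ⟨w, rfl⟩
    · exact ((roughCut_le_iff hR).1 le_rfl).1 y ⟨hjx, hj⟩
    · exact absurd hj (hex w hjx)
  have heq : upperSingleton R x = sSup (upperSingleton R '' Y) := by
    refine le_antisymm ?_ (sSup_le ?_)
    · refine ((pointCut_le_roughCut hR).1 hle).trans ?_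
      rw [upper_eq_biUnion Y]
      exact Set.iUnion₂_subset fun y hy => Set.subset_sUnion_of_mem
        (Set.mem_image_of_mem Subtype.val (Set.mem_image_of_mem (upperSingleton R) hy))
    · rintro _ ⟨y, hy, rfl⟩
      exact (pointCut_le_pointCut hR).1 hy.1
  obtain ⟨y, hy, hyx⟩ := hx _ heq
  have hval : upper R {y} = upper R {x} := congrArg Subtype.val hyx
  rw [le_antisymm ((pointCut_le_pointCut hR).2 hval.ge) hy.1]
  exact hy.2

/-- A neighbourhood cut has a point cut as dual, and lies below a point cut only when both come from
one singleton neighbourhood, where they coincide. -/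
theorem IsCompletelyJoinPrime.eq_dual_or_exists_eq_pointCut (hR : ∀ x, R x x) {p : DM R}
    (hp : IsCompletelyJoinPrime p) (h : p ≤ dual DM.neg p) :
    dual DM.neg p = p ∨ ∃ x ∉ singletons R, p = pointCut R x := by
  have key : ∀ w, IsCompletelyJoinPrime (nbhdCut R w) →
      nbhdCut R w ≤ dual DM.neg (nbhdCut R w) → dual DM.neg (nbhdCut R w) = nbhdCut R w := by
    intro w hw h
    obtain ⟨z, hz, hdual⟩ := exists_dual_nbhdCut_eq hR hw
    rw [hdual] at h ⊢
    obtain ⟨hnb, rfl⟩ := nbhdCut_eq_pointCut hR h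
    rw [pointCut, nbhdCut, hnb]
  rcases hp.eq_pointCut_or_eq_nbhdCut hR with ⟨x, rfl⟩ | ⟨w, rfl⟩
  · by_cases hx : x ∈ singletons R
    · obtain ⟨z, hz⟩ := hx
      obtain rfl := nbhd_eq_singleton hR hz
      have : pointCut R x = nbhdCut R x := by rw [pointCut, nbhdCut, hz]
      rw [this] at hp h ⊢
      exact Or.inl (key x hp h)
    · exact Or.inr ⟨x, hx, rfl⟩
  · exact Or.inl (key w hp h)

/-- Interpolation in `DM(RS)`, in terms of the sets `{x}^▲`. -/
theorem interpolation_iff (hR : ∀ x, R x x) :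
    Interpolation (DM.neg : DM R → DM R) ↔
      ∀ x y : U, x ∉ singletons R → y ∉ singletons R →
        IsCompletelyJoinPrime (pointCut R x) → IsCompletelyJoinPrime (pointCut R y) →
        (∃ u, pointCut R x ≤ pointCut R u ∧ pointCut R y ≤ pointCut R u) →
        ∃ z, IsCompletelyJoinPrime (pointCut R z) ∧
          pointCut R x ≤ pointCut R z ∧ pointCut R y ≤ pointCut R z := by
  have hn := isInvolution_neg (R := R)
  constructor
  · rintro h x y - - hx hy ⟨u, hxu, hyu⟩
    obtain ⟨r, hr, hxr, hyr, hrx, hry⟩ := h _ _ hx hy (hx.pointCut_le_dual hR hxu hxu)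
      (hy.pointCut_le_dual hR hyu hyu) (hy.pointCut_le_dual hR hxu hyu)
    rcases hr.eq_pointCut_or_eq_nbhdCut hR with ⟨z, rfl⟩ | ⟨w, rfl⟩
    · exact ⟨z, hr, hxr, hyr⟩
    -- The interpolation bounds are self-dual, so the dual of `r`, a point cut, is also an
    -- interpolant.
    · obtain ⟨z, -, hz⟩ := exists_dual_nbhdCut_eq hR hr
      have hx' := hr.dual_le_dual hn (hx.prime_dual hn) hrx
      have hy' := hr.dual_le_dual hn (hy.prime_dual hn) hry
      rw [hx.dual_dual hn, hz] at hx'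
      rw [hy.dual_dual hn, hz] at hy'
      exact ⟨z, hz ▸ hr.prime_dual hn, hx', hy'⟩
  · intro h p q hp hq hpp hqq hpq
    have hqp : q ≤ dual DM.neg p := by
      have := hp.dual_le_dual hn (hq.prime_dual hn) hpq
      rwa [hq.dual_dual hn] at this
    rcases hp.eq_dual_or_exists_eq_pointCut hR hpp with hp' | ⟨x, hx, rfl⟩
    · exact ⟨p, hp, le_rfl, hp' ▸ hqp, hpp, hpq⟩
    rcases hq.eq_dual_or_exists_eq_pointCut hR hqq with hq' | ⟨y, hy, rfl⟩
    · exact ⟨q, hq, hq' ▸ hpq, le_rfl, hqp, hqq⟩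
    obtain ⟨z, hz, hxz, hyz⟩ := h x y hx hy hp hq (hp.exists_pointCut_le_of_le_dual hR hq hpq)
    exact ⟨_, hz, hxz, hyz, hp.pointCut_le_dual hR le_rfl hxz, hq.pointCut_le_dual hR le_rfl hyz⟩

end Cuts

end RoughSet

theorem mainTheorem1 {U : Type*} (R : U → U → Prop) (hR : ∀ x, R x x)
    (hdistrib : RoughSet.IsCompletelyDistributive (RoughSet.DM R))
    (hspatial : RoughSet.IsSpatial (RoughSet.DM R)) :
    RoughSet.IsNelsonAlgebra (RoughSet.DM.neg : RoughSet.DM R → RoughSet.DM R) ↔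
      ∀ x y : U, x ∉ RoughSet.singletons R → y ∉ RoughSet.singletons R →
        RoughSet.IsCompletelyJoinIrreducible (RoughSet.upperSingleton R x) →
        RoughSet.IsCompletelyJoinIrreducible (RoughSet.upperSingleton R y) →
        (∃ u : U, RoughSet.upper R {x} ⊆ RoughSet.upper R {u} ∧
          RoughSet.upper R {y} ⊆ RoughSet.upper R {u}) →
        ∃ z : U, RoughSet.IsCompletelyJoinIrreducible (RoughSet.upperSingleton R z) ∧
          RoughSet.upper R {x} ⊆ RoughSet.upper R {z} ∧
          RoughSet.upper R {y} ⊆ RoughSet.upper R {z} := by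
  have hL := hspatial.hasEnoughPrimes hdistrib
  have hn := RoughSet.isInvolution_neg (R := R)
  have hiff : ∀ x, RoughSet.IsCompletelyJoinIrreducible (RoughSet.upperSingleton R x) ↔
      RoughSet.IsCompletelyJoinPrime (RoughSet.pointCut R x) := fun x =>
    ⟨fun h => h.isCompletelyJoinPrime_pointCut hR hL,
      fun h => h.isCompletelyJoinIrreducible_upperSingleton hR⟩
  simp only [hiff, ← RoughSet.pointCut_le_pointCut hR, ← RoughSet.interpolation_iff hR]
  exact ⟨fun h => h.interpolation hL hn,
    fun h => h.isNelsonAlgebra hL hn (RoughSet.inf_neg_le_sup_neg hR)⟩
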